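/- A tournament is a finite digraph without loops in which there is exactly one arc between every pair of distinct vertices. A digraph is strongly connected if it contains a directed $(x,y)$-path for every ordered pair $(x,y)$ of distinct vertices. A digraph is $s$-strong if it has at least $s+1$ vertices and remains strongly connected whenever a set of at most $s-1$ vertices is deleted. A digraph is $k$-linked if for every choice of disjoint sets $\{x_1,\ldots,x_k\}$ and $\{y_1,\ldots,y_k\}$ of $k$ distinct vertices each, there are pairwise vertex-disjoint directed paths $P_1,\ldots,P_k$ such that $P_i$ goes from $x_i$ to $y_i$ for every $i$. **Theorem.** For every natural number $k$, every $(13k-6)$-strong tournament in which every vertex has out-degree at least $28k-13$ is $k$-linked. -/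

import Mathlib

namespace Digraph

/-- The subdigraph induced by a set `X` of vertices. -/
def induce {V : Type*} (D : Digraph V) (X : Set V) : Digraph X where
  Adj a b := D.Adj a b

/-- `D` is a tournament: it has no loops, and there is exactly one arc between every pair of
distinct vertices. -/
def IsTournament {V : Type*} (D : Digraph V) : Prop :=
  (∀ v, ¬ D.Adj v v) ∧ ∀ u v, u ≠ v → Xor (D.Adj u v) (D.Adj v u)

/-- The list `p` of vertices is an `(x, y)`-path of `D`: its vertices are distinct, there is an
arc from each vertex of `p` to the next one, and it begins in `x` and ends in `y`. -/
def IsPath {V : Type*} (D : Digraph V) (x y : V) (p : List V) : Prop :=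
  p.IsChain D.Adj ∧ p.Nodup ∧ p.head? = some x ∧ p.getLast? = some y

/-- `D` has an `(x, y)`-path for every ordered pair of distinct vertices. -/
def IsStronglyConnected {V : Type*} (D : Digraph V) : Prop :=
  ∀ x y, x ≠ y → ∃ p, D.IsPath x y p

/-- `D` is `k`-strong: it has at least `k + 1` vertices, and deleting any set of at most `k - 1`
(that is, fewer than `k`) vertices leaves a strongly connected digraph. -/
def IsKStrong {V : Type*} [Fintype V] (D : Digraph V) (k : ℕ) : Prop :=
  k + 1 ≤ Fintype.card V ∧
    ∀ S : Finset V, S.card < k → (D.induce {v | v ∉ S}).IsStronglyConnected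

/-- The out-degree of `v`: the number of vertices `w ≠ v` such that `v → w` is an arc. -/
noncomputable def outDegree {V : Type*} (D : Digraph V) (v : V) : ℕ :=
  {w | w ≠ v ∧ D.Adj v w}.ncard

/-- `D` is `k`-linked: for all disjoint sets `{x_1, …, x_k}` and `{y_1, …, y_k}` of `k` vertices
each, there are pairwise vertex-disjoint paths `P_1, …, P_k`, where `P_i` is an
`(x_i, y_i)`-path. -/
def IsKLinked {V : Type*} (D : Digraph V) (k : ℕ) : Prop :=
  ∀ x y : Fin k → V, Function.Injective x → Function.Injective y →
    Disjoint (Set.range x) (Set.range y) →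
      ∃ P : Fin k → List V, (∀ i, D.IsPath (x i) (y i) (P i)) ∧
        ∀ i j, i ≠ j → (P i).Disjoint (P j)

end Digraph

/-!
Let `X = {x i}` and `Y = {y i}`, and let `H` consist of `5 * k` vertices outside `X ∪ Y` with
the largest in-degrees, in-neighbours in `X` not being counted. Vertices of large out-degree are
linked to vertices of `H` by many short paths: if no path of length at most three leads from `x`
to `h ∈ H` through a set `F` of allowed vertices, then all in-neighbours of `h` in `F` dominate
all out-neighbours of `x` in `F`. Some out-neighbour `a ∉ H` of `x` is moreover dominated by about
half of the other out-neighbours of `x`, so the in-degree of `a` exceeds that of `h` if only few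
vertices are forbidden (`IsTournament.exists_of_not_isConnector`).

The `i`-th path is the concatenation of three parts.

* A short path from `x i` to a vertex `u i ∈ H`, where `u i` is chosen so as to have many
  out-neighbours in `H` (`IsTournament.exists_isConnector_to_top`).
* A path `Q i` from a vertex `v i` of `H` to `y i`. These paths come from Menger's theorem, applied
  after the deletion of the first parts, which have at most `4 * k` vertices
  (`IsKStrong.exists_isLinkage`), and they are chosen with the least total number of vertices.
* An arc from `u i` to a vertex `w i ∈ H` not on any of the paths `Q j`, and then a short path from
  `w i` to `v i` (`IsTournament.exists_isConnector_avoiding`).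

The paths `Q j` can be arbitrarily long, but by minimality the vertex `w i` has arcs only to the
first two vertices of each of them, and an unused out-neighbour `a` of `w i` only to the first
three. Hence few out-neighbours of `w i` lie on these paths, and `a` is dominated by nearly all of
their vertices, which therefore cancel when the in-degrees of `a` and `v i` are compared.

Both families of short paths are chosen greedily, preferring those with at most one interior vertex
(`exists_disjoint_connectors`); this limits the damage that each of them does to the later ones.
-/

namespace Digraph

open Finset
open scoped Classical

variable {V : Type*}

/-! ### Choosing vertices by degree -/

/-- If `r` relates any two distinct elements of `A` in at least one direction, then some element
of `A` has at least the average number `(#A - 1) / 2` of predecessors in `A`. -/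
theorem exists_card_le_two_mul_card_filter_add_one (r : V → V → Prop) {A : Finset V}
    (hA : A.Nonempty) (hr : ∀ a ∈ A, ∀ b ∈ A, a ≠ b → r a b ∨ r b a) :
    ∃ a ∈ A, #A ≤ 2 * #{b ∈ A | r b a} + 1 := by
  by_contra! h
  have key : ∀ a ∈ A, #{b ∈ A | r b a} < #{b ∈ A | r a b} := by
    intro a ha
    have h1 : A ⊆ insert a ({b ∈ A | r b a} ∪ {b ∈ A | r a b}) := by
      intro b hb
      have := hr a ha b hb
      simp only [mem_insert, mem_union, mem_filter]
      grind
    have h2 := card_le_card h1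
    have h3 := card_insert_le a ({b ∈ A | r b a} ∪ {b ∈ A | r a b})
    have h4 := card_union_le {b ∈ A | r b a} {b ∈ A | r a b}
    have := h a ha
    omega
  have h1 := sum_lt_sum_of_nonempty hA key
  have h2 := sum_card_bipartiteAbove_eq_sum_card_bipartiteBelow (s := A) (t := A) r
  simp only [bipartiteAbove, bipartiteBelow] at h2
  omega

theorem exists_subset_card_eq_forall_le (f : V → ℕ) (S : Finset V) (m : ℕ) (hm : m ≤ #S) :
    ∃ H ⊆ S, #H = m ∧ ∀ h ∈ H, ∀ a ∈ S, a ∉ H → f a ≤ f h := by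
  induction m with
  | zero => exact ⟨∅, by simp⟩
  | succ m ih =>
    obtain ⟨H, hHS, hc, hH⟩ := ih (by omega)
    have hne : (S \ H).Nonempty := by
      rw [← card_pos, card_sdiff_of_subset hHS]; omega
    obtain ⟨c, hcS, hmax⟩ := exists_max_image (S \ H) f hne
    rw [mem_sdiff] at hcS
    refine ⟨insert c H, insert_subset hcS.1 hHS, by rw [card_insert_of_notMem hcS.2, hc], ?_⟩
    intro h hh a ha haH
    rw [mem_insert, not_or] at haH
    rcases mem_insert.1 hh with rfl | hh
    · exact hmax a (by simp [ha, haH.2])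
    · exact hH h hh a ha haH.2

theorem exists_injective_of_lt_card {k : ℕ} (S : Fin k → Finset V)
    (h : ∀ i : Fin k, (i : ℕ) < #(S i)) : ∃ w : Fin k → V, Function.Injective w ∧ ∀ i, w i ∈ S i := by
  refine (Finset.all_card_le_biUnion_card_iff_exists_injective S).1 fun s => ?_
  rcases s.eq_empty_or_nonempty with rfl | hs
  · simp
  · have h1 : s ⊆ Iic (s.max' hs) := fun i hi => mem_Iic.2 (s.le_max' i hi)
    have h2 := card_le_card h1
    rw [Fin.card_Iic] at h2
    have h3 : S (s.max' hs) ⊆ s.biUnion S := subset_biUnion_of_mem S (s.max'_mem hs)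
    have := card_le_card h3
    have := h (s.max' hs)
    omega

theorem IsTournament.asymm {T : Digraph V} (hT : T.IsTournament) {a b : V} (h : T.Adj a b) :
    ¬ T.Adj b a := by
  intro h'
  rcases eq_or_ne a b with rfl | hne
  · exact hT.1 _ h
  · rcases hT.2 a b hne with h1 | h1
    · exact h1.2 h'
    · exact h1.2 h

theorem IsTournament.total {T : Digraph V} (hT : T.IsTournament) {a b : V} (h : a ≠ b) :
    T.Adj a b ∨ T.Adj b a := (hT.2 a b h).or

/-- In a tournament of order `m` one can successively remove vertices `u 0, u 1, …` of maximum
out-degree; the later removals cost `u i` at most `k - 1 - i` out-neighbours. -/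
theorem IsTournament.exists_large_outDegree {T : Digraph V} (hT : T.IsTournament) (k : ℕ)
    (H : Finset V) (hk : k ≤ #H) :
    ∃ u : Fin k → V, Function.Injective u ∧ (∀ i, u i ∈ H) ∧
      ∀ i : Fin k, #H + i + 1 ≤ 2 * #{b ∈ H | b ∉ Set.range u ∧ T.Adj (u i) b} + 2 * k := by
  induction k generalizing H with
  | zero => exact ⟨Fin.elim0, fun i => i.elim0, fun i => i.elim0, fun i => i.elim0⟩
  | succ k ih =>
    obtain ⟨a, ha, hdeg⟩ := exists_card_le_two_mul_card_filter_add_one (flip T.Adj)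
      (A := H) (card_pos.1 (by omega)) (fun a _ b _ hab => (hT.total hab).symm)
    have hcard := card_erase_of_mem ha
    obtain ⟨u, hu, huH, hd⟩ := ih (H.erase a) (by omega)
    have hua : ∀ i, u i ≠ a := fun i => ne_of_mem_erase (huH i)
    refine ⟨Fin.cons a u, Fin.cons_injective_iff.2 ⟨by simpa using hua, hu⟩, ?_, ?_⟩
    · intro i
      cases i using Fin.cases with
      | zero => simpa using ha
      | succ i => simpa using mem_of_mem_erase (huH i)
    · intro i
      cases i using Fin.cases with
      | zero =>
        have h1 : {b ∈ H | flip T.Adj b a} ⊆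
            {b ∈ H | b ∉ Set.range (Fin.cons a u : Fin (k + 1) → V) ∧
              T.Adj ((Fin.cons a u : Fin (k + 1) → V) 0) b} ∪ univ.image u := by
          intro b hb
          rw [mem_filter] at hb
          have hba : b ≠ a := by rintro rfl; exact hT.1 _ hb.2
          by_cases hbu : b ∈ Set.range u
          · exact mem_union_right _ (by simpa using hbu)
          · refine mem_union_left _ (mem_filter.2 ⟨hb.1, ?_, hb.2⟩)
            rw [Fin.range_cons]
            simpa [hba] using hbu
        have h2 := (card_le_card h1).trans (card_union_le _ _)
        have h3 : #(univ.image u) ≤ k := card_image_le.trans (by simp)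
        simp only [Fin.val_zero]
        omega
      | succ i =>
        have h1 : {b ∈ H.erase a | b ∉ Set.range u ∧ T.Adj (u i) b} ⊆
            {b ∈ H | b ∉ Set.range (Fin.cons a u : Fin (k + 1) → V) ∧
              T.Adj ((Fin.cons a u : Fin (k + 1) → V) i.succ) b} := by
          intro b hb
          simp only [mem_filter, mem_erase, Fin.range_cons, Set.mem_insert_iff, Fin.cons_succ]
            at hb ⊢
          tauto
        have h2 := card_le_card h1
        have h3 := hd i
        simp only [Fin.val_succ]
        omega

/-! ### Short connecting paths -/

/-- The list `l` consists of at most two vertices of `F` and is the interior of an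
`(x, u)`-path. -/
def IsConnector (T : Digraph V) (F : Finset V) (x u : V) (l : List V) : Prop :=
  l.length ≤ 2 ∧ l.Nodup ∧ (∀ z ∈ l, z ∈ F) ∧ (x :: (l ++ [u])).IsChain T.Adj

theorem IsConnector.mono {T : Digraph V} {F G : Finset V} {x u : V} {l : List V}
    (h : T.IsConnector F x u l) (hFG : F ⊆ G) : T.IsConnector G x u l :=
  ⟨h.1, h.2.1, fun z hz => hFG (h.2.2.1 z hz), h.2.2.2⟩

/-- If no path of length at most three leads from `x` to `u` through `F`, then some
`a ∈ A` is dominated by all in-neighbours of `u` in `F` and, besides, by about half of the set `A`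
of out-neighbours of `x`, which is disjoint from them. -/
theorem IsTournament.exists_of_not_isConnector {T : Digraph V} (hT : T.IsTournament) {x u : V}
    {F A : Finset V} (hu : u ∉ F) (hA : A.Nonempty) (hAF : A ⊆ F)
    (hxA : ∀ a ∈ A, T.Adj x a) (hno : ¬ ∃ l, T.IsConnector F x u l) :
    ∃ a ∈ A, T.Adj u a ∧
      #A + 2 * #{b ∈ F | T.Adj b u} ≤ 2 * #{b ∈ F | T.Adj b a} + 1 := by
  obtain ⟨a, ha, hdeg⟩ := exists_card_le_two_mul_card_filter_add_one T.Adj hA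
    (fun a _ b _ hab => hT.total hab)
  have h1 : ∀ c ∈ A, ¬ T.Adj c u := fun c hc hcu =>
    hno ⟨[c], by simp [IsConnector, hAF hc, hxA c hc, hcu]⟩
  have h2 : ∀ b ∈ F, T.Adj b u → T.Adj b a := by
    intro b hb hbu
    have hba : b ≠ a := by rintro rfl; exact h1 b ha hbu
    by_contra hn
    have hab := (hT.total hba).resolve_left hn
    exact hno ⟨[a, b], by simp [IsConnector, hAF ha, hxA a ha, hab, hb, hbu, hba.symm]⟩
  refine ⟨a, ha, (hT.total (fun h => hu (by rw [h]; exact hAF ha))).resolve_right (h1 a ha), ?_⟩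
  have hd : Disjoint {b ∈ A | T.Adj b a} {b ∈ F | T.Adj b u} := by
    rw [disjoint_left]
    intro b hb hb'
    exact h1 b (mem_filter.1 hb).1 (mem_filter.1 hb').2
  have hs : {b ∈ A | T.Adj b a} ∪ {b ∈ F | T.Adj b u} ⊆ {b ∈ F | T.Adj b a} := by
    intro b hb
    simp only [mem_union, mem_filter] at hb ⊢
    rcases hb with hb | hb
    · exact ⟨hAF hb.1, hb.2⟩
    · exact ⟨hb.1, h2 b hb.1 hb.2⟩
  have := card_le_card hs
  rw [card_union_of_disjoint hd] at this
  omega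

/-- Greedy choice of disjoint connectors. A connector with at most one interior vertex is taken
whenever there is one. Hence the interior vertices of a longer one are never at once
out-neighbours of `w i` and in-neighbours of `v i` for a pair `i` that is still to be connected,
and each connector adds at most `4` to the weight
`2 * #{c ∈ C | T.Adj c (v i)} + #{c ∈ C | T.Adj (w i) c}` of the set `C` of used vertices. -/
theorem exists_disjoint_connectors (T : Digraph V) {k : ℕ} (w v : Fin k → V) (F : Finset V)
    (h : ∀ i, ∀ C : Finset V,
      2 * #{c ∈ C | T.Adj c (v i)} + #{c ∈ C | T.Adj (w i) c} ≤ 4 * (k - 1) →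
        ∃ l, T.IsConnector (F \ C) (w i) (v i) l) :
    ∃ l : Fin k → List V, (∀ i, T.IsConnector F (w i) (v i) (l i)) ∧
      ∀ i j, i ≠ j → (l i).Disjoint (l j) := by
  have main : ∀ n ≤ k, ∃ (J : Finset (Fin k)) (l : Fin k → List V) (C : Finset V), #J = n ∧
      (∀ i ∈ J, T.IsConnector F (w i) (v i) (l i)) ∧
      (∀ i ∈ J, ∀ j ∈ J, i ≠ j → (l i).Disjoint (l j)) ∧
      (∀ i ∈ J, ∀ z ∈ l i, z ∈ C) ∧
      ∀ i ∉ J, 2 * #{c ∈ C | T.Adj c (v i)} + #{c ∈ C | T.Adj (w i) c} ≤ 4 * n := by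
    intro n
    induction n with
    | zero => exact fun _ => ⟨∅, fun _ => [], ∅, by simp⟩
    | succ n ih =>
      intro hn
      obtain ⟨J, l, C, hJ, hconn, hdisj, hC, hw⟩ := ih (by omega)
      have step : ∃ i ∉ J, ∃ l', T.IsConnector (F \ C) (w i) (v i) l' ∧ ∀ j ∉ J,
          2 * #{c ∈ l'.toFinset | T.Adj c (v j)} + #{c ∈ l'.toFinset | T.Adj (w j) c} ≤ 4 := by
        by_cases hs : ∃ i ∉ J, ∃ l', T.IsConnector (F \ C) (w i) (v i) l' ∧ l'.length ≤ 1
        · obtain ⟨i, hi, l', hl', hlen⟩ := hs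
          refine ⟨i, hi, l', hl', fun j _ => ?_⟩
          have h1 := l'.toFinset_card_le
          have h2 := card_filter_le l'.toFinset (fun c => T.Adj c (v j))
          have h3 := card_filter_le l'.toFinset (fun c => T.Adj (w j) c)
          omega
        · obtain ⟨i, hi⟩ : ∃ i, i ∉ J := by
            by_contra! hall
            have : J = univ := eq_univ_iff_forall.2 hall
            rw [this, card_univ, Fintype.card_fin] at hJ
            omega
          obtain ⟨l', hl'⟩ := h i C ((hw i hi).trans (by omega))
          refine ⟨i, hi, l', hl', fun j hj => ?_⟩
          have hd : Disjoint {c ∈ l'.toFinset | T.Adj c (v j)}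
              {c ∈ l'.toFinset | T.Adj (w j) c} := by
            rw [disjoint_left]
            intro c hc hc'
            rw [mem_filter, List.mem_toFinset] at hc hc'
            exact hs ⟨j, hj, [c], by simp [IsConnector, hc.2, hc'.2]; simpa using hl'.2.2.1 c hc.1,
              by simp⟩
          have h1 := card_le_card (union_subset (filter_subset (fun c => T.Adj c (v j)) l'.toFinset)
            (filter_subset (fun c => T.Adj (w j) c) l'.toFinset))
          rw [card_union_of_disjoint hd] at h1
          have h2 := l'.toFinset_card_le
          have h3 := hl'.1
          have h4 := card_filter_le l'.toFinset (fun c => T.Adj c (v j))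
          omega
      obtain ⟨i, hi, l', hl', hw'⟩ := step
      have hfree : ∀ z ∈ l', z ∉ C := fun z hz => (mem_sdiff.1 (hl'.2.2.1 z hz)).2
      refine ⟨insert i J, Function.update l i l', C ∪ l'.toFinset,
        by rw [card_insert_of_notMem hi, hJ], ?_, ?_, ?_, ?_⟩
      · intro j hj
        rcases eq_or_ne j i with rfl | hji
        · simpa using hl'.mono sdiff_subset
        · simpa [hji] using hconn j ((mem_insert.1 hj).resolve_left hji)
      · intro a ha b hb hab
        rw [mem_insert] at ha hb
        intro z hza hzb
        rcases eq_or_ne a i with rfl | hai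
        · rw [Function.update_self] at hza
          rw [Function.update_of_ne hab.symm] at hzb
          exact hfree z hza (hC b (hb.resolve_left hab.symm) z hzb)
        · rw [Function.update_of_ne hai] at hza
          rcases eq_or_ne b i with rfl | hbi
          · rw [Function.update_self] at hzb
            exact hfree z hzb (hC a (ha.resolve_left hai) z hza)
          · rw [Function.update_of_ne hbi] at hzb
            exact hdisj a (ha.resolve_left hai) b (hb.resolve_left hbi) hab hza hzb
      · intro j hj z hz
        rcases eq_or_ne j i with rfl | hji
        · rw [Function.update_self] at hz
          exact mem_union_right _ (List.mem_toFinset.2 hz)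
        · rw [Function.update_of_ne hji] at hz
          exact mem_union_left _ (hC j ((mem_insert.1 hj).resolve_left hji) z hz)
      · intro j hj
        rw [mem_insert, not_or] at hj
        have h1 := hw j hj.2
        have h2 := hw' j hj.2
        rw [filter_union, filter_union]
        have h3 := card_union_le {c ∈ C | T.Adj c (v j)} {c ∈ l'.toFinset | T.Adj c (v j)}
        have h4 := card_union_le {c ∈ C | T.Adj (w j) c} {c ∈ l'.toFinset | T.Adj (w j) c}
        omega
  obtain ⟨J, l, C, hJ, hconn, hdisj, -⟩ := main k le_rfl
  have : J = univ := by
    rw [← card_eq_iff_eq_univ, hJ, Fintype.card_fin]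
  subst this
  exact ⟨l, fun i => hconn i (mem_univ i), fun i j => hdisj i (mem_univ i) j (mem_univ j)⟩

/-! ### Menger's theorem -/

/-- **Menger's theorem** for directed graphs, in the form: if `A` cannot be separated from `B` by
fewer than `k` vertices, then there are `k` disjoint paths from `A` to `B`.

Hall's theorem provides an injection which maps each vertex outside `B` to itself or to an
out-neighbour and each of `k` additional sources into `A`; iterating it from the sources traces
out the paths. -/
theorem exists_disjoint_paths [Fintype V] (r : V → V → Prop) {k : ℕ} (A B : Finset V)
    (h : ∀ C : Finset V, #C < k →
      ∃ a ∈ A, a ∉ C ∧ ∃ b ∈ B, Relation.ReflTransGen (fun u v => r u v ∧ v ∉ C) a b) :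
    ∃ P : Fin k → List V, (∀ i, (P i).IsChain r ∧ (P i).Nodup ∧
      (∃ a ∈ A, (P i).head? = some a) ∧ ∃ b ∈ B, (P i).getLast? = some b) ∧
      ∀ i j, i ≠ j → (P i).Disjoint (P j) := by
  let t : {v // v ∉ B} ⊕ Fin k → Finset V :=
    Sum.elim (fun v => insert v.1 (univ.filter (r v.1))) (fun _ => A)
  obtain ⟨f, hf, hft⟩ : ∃ f : {v // v ∉ B} ⊕ Fin k → V, Function.Injective f ∧ ∀ x, f x ∈ t x := by
    refine (Finset.all_card_le_biUnion_card_iff_exists_injective t).1 fun s => ?_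
    have hs := card_toLeft_add_card_toRight (u := s)
    set X : Finset V := s.toLeft.map (Function.Embedding.subtype _) with hX
    have hXc : #X = #s.toLeft := card_map _
    have hXs : X ⊆ s.biUnion t := by
      intro v hv
      obtain ⟨z, hz, rfl⟩ := mem_map.1 hv
      exact mem_biUnion.2 ⟨.inl z, mem_toLeft.1 hz, by simp [t]⟩
    rcases s.toRight.eq_empty_or_nonempty with h0 | ⟨i, hi⟩
    · have := card_le_card hXs
      rw [h0, card_empty] at hs
      omega
    · have hC : k ≤ #(s.biUnion t \ X) := by
        by_contra! hlt
        obtain ⟨a, ha, haC, b, hb, hab⟩ := h _ hlt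
        have haX : a ∈ X := by
          by_contra hn
          exact haC (mem_sdiff.2 ⟨mem_biUnion.2 ⟨.inr i, mem_toRight.1 hi, by simpa [t] using ha⟩,
            hn⟩)
        have hbX : b ∈ X := by
          clear hb
          induction hab with
          | refl => exact haX
          | tail _ hr ih =>
            by_contra hn
            obtain ⟨z, hz, rfl⟩ := mem_map.1 ih
            exact hr.2 (mem_sdiff.2 ⟨mem_biUnion.2 ⟨.inl z, mem_toLeft.1 hz, by
              simpa [t] using Or.inr hr.1⟩, hn⟩)
        obtain ⟨z, hz, rfl⟩ := mem_map.1 hbX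
        exact z.2 hb
      have h1 := card_sdiff_add_card_eq_card hXs
      have h2 : #s.toRight ≤ k := by simpa using card_le_univ s.toRight
      omega
  let g : V → V := fun v => if hv : v ∉ B then f (.inl ⟨v, hv⟩) else v
  have hg : ∀ v (hv : v ∉ B), g v = f (.inl ⟨v, hv⟩) := fun v hv => dif_pos hv
  let a : Fin k → V := fun i => f (.inr i)
  have cancel : ∀ i j m n, (∀ s < m, g^[s] (a i) ∉ B) → (∀ s < n, g^[s] (a j) ∉ B) →
      g^[m] (a i) = g^[n] (a j) → i = j ∧ m = n := by
    intro i j m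
    induction m with
    | zero =>
      intro n _ hn he
      cases n with
      | zero => simpa [a, hf.eq_iff] using he
      | succ n =>
        rw [Function.iterate_succ_apply', hg _ (hn n n.lt_succ_self)] at he
        simpa using hf he
    | succ m ih =>
      intro n hm hn he
      cases n with
      | zero =>
        rw [Function.iterate_succ_apply', hg _ (hm m m.lt_succ_self)] at he
        simpa using hf he
      | succ n =>
        rw [Function.iterate_succ_apply', Function.iterate_succ_apply',
          hg _ (hm m m.lt_succ_self), hg _ (hn n n.lt_succ_self)] at he
        have := ih n (fun s hs => hm s (by omega)) (fun s hs => hn s (by omega))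
          (by simpa using hf he)
        omega
  have hex : ∀ i, ∃ n, g^[n] (a i) ∈ B := by
    intro i
    by_contra! hn
    exact not_injective_infinite_finite (fun n => g^[n] (a i)) fun m n hmn =>
      (cancel i i m n (fun s _ => hn s) (fun s _ => hn s) hmn).2
  have hmin : ∀ i, ∀ s < Nat.find (hex i), g^[s] (a i) ∉ B := fun i s hs =>
    Nat.find_min (hex i) hs
  have hcan : ∀ i j m n, m ≤ Nat.find (hex i) → n ≤ Nat.find (hex j) →
      g^[m] (a i) = g^[n] (a j) → i = j ∧ m = n := fun i j m n hm hn =>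
    cancel i j m n (fun s hs => hmin i s (by omega)) (fun s hs => hmin j s (by omega))
  refine ⟨fun i => (List.range (Nat.find (hex i) + 1)).map (fun n => g^[n] (a i)), ?_, ?_⟩
  · intro i
    refine ⟨?_, ?_, ⟨a i, hft _, ?_⟩, _, Nat.find_spec (hex i), ?_⟩
    · rw [List.isChain_iff_getElem]
      intro n hn
      simp only [List.length_map, List.length_range, List.getElem_map, List.getElem_range] at hn ⊢
      have h1 := hmin i n (by omega)
      have h2 := hft (.inl ⟨_, h1⟩)
      rw [← hg _ h1, ← Function.iterate_succ_apply' g] at h2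
      simp only [t, Sum.elim_inl, mem_insert, mem_filter, mem_univ, true_and] at h2
      refine h2.resolve_left fun he => ?_
      have := hcan i i (n + 1) n (by omega) (by omega) he
      omega
    · refine List.Nodup.map_on ?_ List.nodup_range
      intro m hm n hn he
      rw [List.mem_range] at hm hn
      exact (hcan i i m n (by omega) (by omega) he).2
    · simp [List.range_succ_eq_map]
    · simp [List.range_succ]
  · intro i j hij z hi hj
    simp only [List.mem_map, List.mem_range] at hi hj
    obtain ⟨m, hm, rfl⟩ := hi
    obtain ⟨n, hn, he⟩ := hj
    exact hij (hcan i j m n (by omega) (by omega) he.symm).1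

/-! ### Minimum linkages -/

/-- `Q` is a system of disjoint paths of `T` which avoid `D`; the path `Q j` leads from a vertex
of `S` to `y j`. -/
structure IsLinkage (T : Digraph V) (D S : Finset V) {k : ℕ} (y : Fin k → V)
    (Q : Fin k → List V) : Prop where
  isChain : ∀ j, (Q j).IsChain T.Adj
  nodup : ∀ j, (Q j).Nodup
  head : ∀ j, ∃ s ∈ S, (Q j).head? = some s
  last : ∀ j, (Q j).getLast? = some (y j)
  avoid : ∀ j, ∀ z ∈ Q j, z ∉ D
  disjoint : ∀ i j, i ≠ j → (Q i).Disjoint (Q j)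

/-- `Q` is a linkage with the least total number of vertices. -/
structure IsMinLinkage (T : Digraph V) (D S : Finset V) {k : ℕ} (y : Fin k → V)
    (Q : Fin k → List V) : Prop extends T.IsLinkage D S y Q where
  le : ∀ Q', T.IsLinkage D S y Q' → ∑ j, (Q j).length ≤ ∑ j, (Q' j).length

theorem IsLinkage.exists_isMinLinkage {T : Digraph V} {D S : Finset V} {k : ℕ} {y : Fin k → V}
    {Q : Fin k → List V} (h : T.IsLinkage D S y Q) : ∃ Q', T.IsMinLinkage D S y Q' := by
  obtain ⟨Q', hQ', hmin⟩ := (measure fun Q : Fin k → List V => ∑ j, (Q j).length).wf.has_min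
    {Q | T.IsLinkage D S y Q} ⟨Q, h⟩
  exact ⟨Q', hQ', fun Q'' hQ'' => not_lt.1 (hmin Q'' hQ'')⟩

theorem forall_mem_of_isChain_cons {r : V → V → Prop} {p : V → Prop} {c : V} {l : List V}
    (h : (c :: l).IsChain r) (hc : p c) (hr : ∀ a b, r a b → p b) : ∀ z ∈ c :: l, p z := by
  induction l generalizing c with
  | nil => simpa using hc
  | cons d l ih =>
    rw [List.isChain_cons_cons] at h
    simpa [hc] using ih h.2 (hr _ _ h.1)

theorem IsKStrong.exists_isLinkage [Fintype V] {T : Digraph V} {s k : ℕ} (hT : T.IsKStrong s)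
    {D S : Finset V} {y : Fin k → V} (hy : Function.Injective y) (hD : #D + k ≤ s)
    (hS : k ≤ #S) (hSD : Disjoint S D) (hyD : ∀ j, y j ∉ D) (hyS : ∀ j, y j ∉ S) :
    ∃ Q, T.IsLinkage D S y Q := by
  obtain ⟨P, hP, hdisj⟩ := exists_disjoint_paths (fun a b => T.Adj a b ∧ b ∉ D) (k := k) S
    (univ.image y) (by
      intro C hC
      have hcy : #(univ.image y) = k := by rw [card_image_of_injective _ hy]; simp
      obtain ⟨a, ha, haC⟩ := exists_mem_notMem_of_card_lt_card (hC.trans_le hS)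
      obtain ⟨b, hb, hbC⟩ := exists_mem_notMem_of_card_lt_card (hC.trans_le hcy.ge)
      have hcard : #(D ∪ C) < s := (card_union_le _ _).trans_lt (by omega)
      obtain ⟨j, -, rfl⟩ := mem_image.1 hb
      have haD := disjoint_left.1 hSD ha
      obtain ⟨p, hp, -, hp1, hp2⟩ := hT.2 (D ∪ C) hcard ⟨a, by simp [haC, haD]⟩
        ⟨y j, by simp [hbC, hyD j]⟩ (by rintro ⟨⟩; exact hyS j ha)
      refine ⟨a, ha, haC, y j, hb, ?_⟩
      cases p with
      | nil => simp at hp1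
      | cons c p =>
        simp only [List.head?_cons, Option.some.injEq] at hp1
        subst hp1
        have h1 := List.relationReflTransGen_of_exists_isChain_cons p hp
          (by simpa [List.getLast?_eq_some_getLast] using hp2)
        refine Relation.ReflTransGen.lift (fun z : {v | v ∉ D ∪ C} => z.1) ?_ _ _ h1
        intro z z' hz
        have := z'.2
        simp only [Set.mem_ofPred_eq, mem_union, not_or] at this
        exact ⟨⟨hz, this.1⟩, this.2⟩)
  have hlast : ∀ i, ∃ j, (P i).getLast? = some (y j) := by
    intro i
    obtain ⟨b, hb, hb'⟩ := (hP i).2.2.2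
    obtain ⟨j, -, rfl⟩ := mem_image.1 hb
    exact ⟨j, hb'⟩
  choose e he using hlast
  have hinj : Function.Injective e := by
    intro i i' hii
    by_contra hne
    have h1 := List.mem_of_getLast? (he i)
    have h2 := List.mem_of_getLast? (he i')
    rw [← hii] at h2
    exact hdisj i i' hne h1 h2
  let σ := Equiv.ofBijective e (Finite.injective_iff_bijective.1 hinj)
  refine ⟨fun j => P (σ.symm j), fun j => (hP _).1.imp fun _ _ h => h.1, fun j => (hP _).2.1,
    fun j => (hP _).2.2.1, fun j => ?_, fun j z hz => ?_, fun i j hij => ?_⟩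
  · rw [he]
    congr 2
    exact σ.apply_symm_apply j
  · obtain ⟨a, ha, ha'⟩ := (hP (σ.symm j)).2.2.1
    have hc := (hP (σ.symm j)).1
    cases hl : P (σ.symm j) with
    | nil => simp [hl] at hz
    | cons c l =>
      rw [hl] at hz ha' hc
      simp only [List.head?_cons, Option.some.injEq] at ha'
      subst ha'
      exact forall_mem_of_isChain_cons hc (disjoint_left.1 hSD ha) (fun _ _ h => h.2) z hz
  · exact hdisj _ _ fun h => hij (σ.symm.injective h)

/-- A segment at the beginning of a path of a minimum linkage cannot be replaced by a shorter
list of unused vertices. -/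
theorem IsMinLinkage.length_le {T : Digraph V} {D S : Finset V} {k : ℕ} {y : Fin k → V}
    {Q : Fin k → List V} (h : T.IsMinLinkage D S y Q) {j : Fin k} {q : V} {pre suf p : List V}
    (hj : Q j = pre ++ q :: suf) (hchain : (p ++ [q]).IsChain T.Adj) (hp : p.Nodup)
    (hhead : ∃ s ∈ S, (p ++ [q]).head? = some s) (hpD : ∀ z ∈ p, z ∉ D)
    (hpQ : ∀ z ∈ p, ∀ i, z ∉ Q i) : pre.length ≤ p.length := by
  have hsub : ∀ z ∈ q :: suf, z ∈ Q j := fun z hz => hj ▸ List.mem_append_right _ hz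
  have hne : p ++ q :: suf = (p ++ [q]) ++ suf := by simp
  have hl : T.IsLinkage D S y (Function.update Q j (p ++ q :: suf)) := by
    have hnd := h.nodup j
    have hch := h.isChain j
    have hla := h.last j
    rw [hj] at hnd hch hla
    have hmem : ∀ z, z ∈ p ++ q :: suf → z ∈ p ∨ z ∈ Q j := fun z hz =>
      (List.mem_append.1 hz).imp_right (hsub z)
    refine ⟨fun i => ?_, fun i => ?_, fun i => ?_, fun i => ?_, fun i => ?_, fun i i' hii => ?_⟩
    · rcases eq_or_ne i j with rfl | hi
      · rw [Function.update_self]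
        rw [List.isChain_split] at hch ⊢
        exact ⟨hchain, hch.2⟩
      · simpa [hi] using h.isChain i
    · rcases eq_or_ne i j with rfl | hi
      · rw [Function.update_self]
        refine List.nodup_append'.2 ⟨hp, (List.nodup_append'.1 hnd).2.1, fun z hz hz' => ?_⟩
        exact hpQ z hz i (hsub z hz')
      · simpa [hi] using h.nodup i
    · rcases eq_or_ne i j with rfl | hi
      · obtain ⟨s, hs, hs'⟩ := hhead
        refine ⟨s, hs, ?_⟩
        rw [Function.update_self, hne, List.head?_append, hs']
        rfl
      · simpa [hi] using h.head i
    · rcases eq_or_ne i j with rfl | hi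
      · rw [Function.update_self]
        simpa [List.getLast?_append] using hla
      · simpa [hi] using h.last i
    · rcases eq_or_ne i j with rfl | hi
      · rw [Function.update_self]
        exact fun z hz => (hmem z hz).elim (hpD z) (h.avoid i z)
      · simpa [hi] using h.avoid i
    · intro z hz hz'
      rcases eq_or_ne i j with rfl | hi
      · rw [Function.update_self] at hz
        rw [Function.update_of_ne hii.symm] at hz'
        exact (hmem z hz).elim (fun hz => hpQ z hz _ hz') fun hz => h.disjoint _ _ hii hz hz'
      · rw [Function.update_of_ne hi] at hz
        rcases eq_or_ne i' j with rfl | hi'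
        · rw [Function.update_self] at hz'
          exact (hmem z hz').elim (fun hz' => hpQ z hz' _ hz) fun hz' =>
            h.disjoint _ _ hii hz hz'
        · rw [Function.update_of_ne hi'] at hz'
          exact h.disjoint _ _ hii hz hz'
  have h1 := h.le _ hl
  have h2 : ∑ i ∈ univ.erase j, (Function.update Q j (p ++ q :: suf) i).length =
      ∑ i ∈ univ.erase j, (Q i).length :=
    sum_congr rfl fun i hi => by rw [Function.update_of_ne (ne_of_mem_erase hi)]
  rw [← add_sum_erase _ _ (mem_univ j), ← add_sum_erase _ _ (mem_univ j), h2] at h1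
  rw [Function.update_self, hj] at h1
  simp only [List.length_append, List.length_cons] at h1
  omega

theorem mem_take_of_eq_append {l pre suf : List V} {q : V} {n : ℕ} (h : l = pre ++ q :: suf)
    (hn : pre.length < n) : q ∈ l.take n := by
  rw [List.mem_take_iff_getElem]
  exact ⟨pre.length, by simp [h]; omega, by simp [h]⟩

theorem IsMinLinkage.head_of_mem {T : Digraph V} {D S : Finset V} {k : ℕ} {y : Fin k → V}
    {Q : Fin k → List V} (h : T.IsMinLinkage D S y Q) {j : Fin k} {s : V} (hs : s ∈ S)
    (hq : s ∈ Q j) : (Q j).head? = some s := by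
  obtain ⟨pre, suf, hj⟩ := List.append_of_mem hq
  have := h.length_le hj (p := []) (by simp) (by simp) ⟨s, hs, by simp⟩ (by simp) (by simp)
  have : pre = [] := by simpa using this
  simp [hj, this]

theorem IsMinLinkage.mem_take_two {T : Digraph V} {D S : Finset V} {k : ℕ} {y : Fin k → V}
    {Q : Fin k → List V} (h : T.IsMinLinkage D S y Q) {j : Fin k} {w q : V} (hw : w ∈ S)
    (hwD : w ∉ D) (hwQ : ∀ i, w ∉ Q i) (hq : q ∈ Q j) (hwq : T.Adj w q) :
    q ∈ (Q j).take 2 := by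
  obtain ⟨pre, suf, hj⟩ := List.append_of_mem hq
  have := h.length_le hj (p := [w]) (by simpa using hwq) (by simp) ⟨w, hw, by simp⟩
    (by simpa using hwD) (by simpa using hwQ)
  exact mem_take_of_eq_append hj (Nat.lt_succ_of_le this)

theorem IsMinLinkage.mem_take_three {T : Digraph V} {D S : Finset V} {k : ℕ} {y : Fin k → V}
    {Q : Fin k → List V} (h : T.IsMinLinkage D S y Q) {j : Fin k} {w a q : V} (hw : w ∈ S)
    (hwD : w ∉ D) (hwQ : ∀ i, w ∉ Q i) (haD : a ∉ D) (haQ : ∀ i, a ∉ Q i) (hne : w ≠ a)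
    (hwa : T.Adj w a) (hq : q ∈ Q j) (haq : T.Adj a q) : q ∈ (Q j).take 3 := by
  obtain ⟨pre, suf, hj⟩ := List.append_of_mem hq
  have := h.length_le hj (p := [w, a]) (by simp [hwa, haq]) (by simpa using hne)
    ⟨w, hw, by simp⟩ (by simp [hwD, haD]) (by simp; exact ⟨hwQ, haQ⟩)
  exact mem_take_of_eq_append hj (Nat.lt_succ_of_le this)

section InDegree

/-! ### Connecting to vertices of large in-degree -/

variable [Fintype V]

/-- The in-neighbours of `v` outside `X`. -/
noncomputable def inNeighborsOutside (T : Digraph V) (X : Finset V) (v : V) : Finset V :=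
  {b | b ∉ X ∧ T.Adj b v}

theorem mem_inNeighborsOutside {T : Digraph V} {X : Finset V} {v b : V} :
    b ∈ T.inNeighborsOutside X v ↔ b ∉ X ∧ T.Adj b v := by
  simp [inNeighborsOutside]

theorem outDegree_le_card {T : Digraph V} {w : V} {S : Finset V}
    (h : ∀ b, b ≠ w → T.Adj w b → b ∈ S) : T.outDegree w ≤ #S := by
  rw [outDegree, ← Set.ncard_coe_finset]
  exact Set.ncard_le_ncard (fun b hb => h b hb.1 hb.2)

/-- A vertex of `X` has a short path to every vertex `u` of `H` through the complement of
`X ∪ Y ∪ H`, even if the vertices in a set `C` of small weight are forbidden. -/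
theorem IsTournament.exists_isConnector_to_top {T : Digraph V} (hT : T.IsTournament) {k : ℕ}
    (hk : 1 ≤ k) {X Y H C : Finset V} (hX : #X = k) (hY : #Y = k) (hH : #H = 5 * k)
    (hXH : Disjoint X H)
    (htop : ∀ h ∈ H, ∀ a ∉ X ∪ Y ∪ H,
      #(T.inNeighborsOutside X a) ≤ #(T.inNeighborsOutside X h))
    {x u : V} (hx : x ∈ X) (hu : u ∈ H) (hdeg : 28 * k - 13 ≤ T.outDegree x)
    (hC : 2 * #{c ∈ C | T.Adj c u} + #{c ∈ C | T.Adj x c} ≤ 4 * (k - 1)) :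
    ∃ l, T.IsConnector ((X ∪ Y ∪ H)ᶜ \ C) x u l := by
  by_contra hno
  set F := (X ∪ Y ∪ H)ᶜ \ C with hF
  have hFm : ∀ z, z ∈ F ↔ (z ∉ X ∧ z ∉ Y ∧ z ∉ H) ∧ z ∉ C := fun z => by
    simp [hF, and_assoc]
  have hxu : ¬ T.Adj x u := fun h => hno ⟨[], by simp [IsConnector, h]⟩
  have huF : u ∉ F := fun h => ((hFm u).1 h).1.2.2 hu
  have huX : u ∉ X := fun h => disjoint_left.1 hXH h hu
  have h1 : T.outDegree x ≤ #{a ∈ F | T.Adj x a} + #(X.erase x) + #Y + #(H.erase u) +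
      #{c ∈ C | T.Adj x c} := by
    refine (outDegree_le_card (S := {a ∈ F | T.Adj x a} ∪ X.erase x ∪ Y ∪ H.erase u ∪
      {c ∈ C | T.Adj x c}) ?_).trans ?_
    · intro b hb hxb
      have : b ≠ u := by rintro rfl; exact hxu hxb
      simp only [mem_union, mem_filter, hFm, mem_erase]
      tauto
    · grw [card_union_le, card_union_le, card_union_le, card_union_le]
  rw [card_erase_of_mem hx, card_erase_of_mem hu] at h1
  obtain ⟨a, ha, hua, hcard⟩ := hT.exists_of_not_isConnector huF
    (A := {a ∈ F | T.Adj x a}) (card_pos.1 (by omega)) (filter_subset _ _)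
    (fun a ha => (mem_filter.1 ha).2) hno
  have haF := (hFm a).1 (mem_filter.1 ha).1
  have h3 : #(T.inNeighborsOutside X u) ≤ #{b ∈ F | T.Adj b u} + #Y + #(H.erase u) +
      #{c ∈ C | T.Adj c u} := by
    have : T.inNeighborsOutside X u ⊆ {b ∈ F | T.Adj b u} ∪ Y ∪ H.erase u ∪
        {c ∈ C | T.Adj c u} := by
      intro b hb
      rw [mem_inNeighborsOutside] at hb
      have : b ≠ u := by rintro rfl; exact hT.1 _ hb.2
      simp only [mem_union, mem_filter, hFm, mem_erase]
      tauto
    grw [this, card_union_le, card_union_le, card_union_le]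
  have h4 : #{b ∈ F | T.Adj b a} + 1 ≤ #(T.inNeighborsOutside X a) := by
    rw [← card_insert_of_notMem (a := u) (fun h => huF (mem_filter.1 h).1)]
    refine card_le_card fun b hb => ?_
    rw [mem_inNeighborsOutside]
    rcases mem_insert.1 hb with rfl | hb
    · exact ⟨huX, hua⟩
    · rw [mem_filter] at hb
      exact ⟨((hFm b).1 hb.1).1.1, hb.2⟩
  -- with `α = #{c ∈ C | T.Adj c u}` and `β = #{c ∈ C | T.Adj x c}`, the set of free
  -- out-neighbours of `x` has at least `21 * k - 11 - β` and at most `12 * k - 3 + 2 * α` elements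
  have h5 := htop u hu a (by simp [haF.1])
  rw [card_erase_of_mem hu] at h3
  omega

/-- The vertices of a minimum linkage `Q`, apart from the first three of each path, dominate
every unused out-neighbour `a` of an unused vertex `w` of `S`. So they do not matter when the
in-degree of `a` is compared with that of a vertex of `H`, although `Q` may be large. -/
theorem IsTournament.exists_isConnector_avoiding {T : Digraph V} (hT : T.IsTournament) {k : ℕ}
    (hk : 1 ≤ k) {X Z U W H C : Finset V} {y : Fin k → V} {Q : Fin k → List V}
    (hX : #X = k) (hZ : #Z ≤ 2 * k) (hU : #U = k) (hW : #W = k) (hH : #H = 5 * k)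
    (hUH : U ⊆ H) (hWH : W ⊆ H)
    (hQ : T.IsMinLinkage (X ∪ Z ∪ U) (H \ U) y Q)
    (htop : ∀ h ∈ H, ∀ a, a ∉ X → a ∉ Set.range y → a ∉ H →
      #(T.inNeighborsOutside X a) ≤ #(T.inNeighborsOutside X h))
    {w v : V} {i : Fin k} (hw : w ∈ W) (hwD : w ∉ X ∪ Z ∪ U) (hwQ : ∀ j, w ∉ Q j)
    (hv : (Q i).head? = some v) (hvS : v ∈ H \ U) (hdeg : 28 * k - 13 ≤ T.outDegree w)
    (hC : 2 * #{c ∈ C | T.Adj c v} + #{c ∈ C | T.Adj w c} ≤ 4 * (k - 1)) :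
    ∃ l, T.IsConnector
      ((X ∪ Z ∪ U ∪ W ∪ univ.biUnion fun j => (Q j).toFinset)ᶜ \ C) w v l := by
  by_contra hno
  set VQ : Finset V := univ.biUnion fun j => (Q j).toFinset with hVQ
  have hVQm : ∀ z, z ∈ VQ ↔ ∃ j, z ∈ Q j := fun z => by simp [hVQ]
  set F := (X ∪ Z ∪ U ∪ W ∪ VQ)ᶜ \ C with hF
  have hFm : ∀ z, z ∈ F ↔ (z ∉ X ∧ z ∉ Z ∧ z ∉ U ∧ z ∉ W ∧ z ∉ VQ) ∧ z ∉ C := fun z => by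
    simp [hF, and_assoc]
  have hvQi : v ∈ Q i := List.mem_of_head? hv
  have hvQ : v ∈ VQ := (hVQm v).2 ⟨i, hvQi⟩
  have hvH : v ∈ H := (mem_sdiff.1 hvS).1
  have hwVQ : w ∉ VQ := fun h => ((hVQm w).1 h).elim hwQ
  have hwH : w ∈ H := hWH hw
  have hwX : w ∉ X := fun h => hwD (by simp [h])
  have hwS : w ∈ H \ U := mem_sdiff.2 ⟨hwH, fun h => hwD (by simp [h])⟩
  have hwv : w ≠ v := by rintro rfl; exact hwVQ hvQ
  have hnwv : ¬ T.Adj w v := fun h => hno ⟨[], by simp [IsConnector, h]⟩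
  have hvF : v ∉ F := fun h => ((hFm v).1 h).1.2.2.2.2 hvQ
  -- the second vertices of the paths
  set Q₂ : Finset V := univ.biUnion fun j => (((Q j).drop 1).take 1).toFinset with hQ₂
  have hQ₂c : #Q₂ ≤ k := by
    refine (card_biUnion_le_card_mul _ _ 1 fun j _ => ?_).trans (by simp)
    exact (List.toFinset_card_le _).trans (by simp)
  have hVQ₂ : ∀ q ∈ VQ, T.Adj w q → q ∈ H ∨ q ∈ Q₂ := by
    intro q hq hwq
    obtain ⟨j, hj⟩ := (hVQm q).1 hq
    have := hQ.mem_take_two hwS hwD hwQ hj hwq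
    obtain ⟨s, hs, hs'⟩ := hQ.head j
    cases hl : Q j with
    | nil => simp [hl] at hj
    | cons c l =>
      rw [hl] at this hs'
      simp only [List.head?_cons, Option.some.injEq] at hs'
      subst hs'
      rw [List.take_succ_cons, List.mem_cons] at this
      refine this.imp (fun h => by rw [h]; exact (mem_sdiff.1 hs).1) fun h => ?_
      exact mem_biUnion.2 ⟨j, mem_univ j, by simpa [hl] using h⟩
  -- the first three vertices of the paths
  set Q₃ : Finset V := univ.biUnion fun j => ((Q j).take 3).toFinset with hQ₃
  have hQ₃c : #Q₃ ≤ 3 * k := by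
    refine (card_biUnion_le_card_mul _ _ 3 fun j _ => ?_).trans (by simp [mul_comm])
    exact (List.toFinset_card_le _).trans (by simp)
  have hvQ₃ : v ∈ Q₃ := by
    refine mem_biUnion.2 ⟨i, mem_univ i, ?_⟩
    cases hl : Q i with
    | nil => simp [hl] at hv
    | cons c l =>
      rw [hl] at hv
      simp only [List.head?_cons, Option.some.injEq] at hv
      simp [hv]
  have hQ₃s : Q₃ ⊆ VQ := by
    intro z hz
    obtain ⟨j, -, hz⟩ := mem_biUnion.1 hz
    exact (hVQm z).2 ⟨j, List.mem_of_mem_take (List.mem_toFinset.1 hz)⟩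
  set A : Finset V := {a ∈ F | a ∉ H ∧ T.Adj w a} with hA
  have h1 : T.outDegree w ≤ #A + #X + #Z + #Q₂ + #((H.erase w).erase v) +
      #{c ∈ C | T.Adj w c} := by
    refine (outDegree_le_card (S := A ∪ X ∪ Z ∪ Q₂ ∪ (H.erase w).erase v ∪
      {c ∈ C | T.Adj w c}) ?_).trans ?_
    · intro b hb hwb
      have h1 : b ≠ v := by rintro rfl; exact hnwv hwb
      have h2 := fun h => hVQ₂ b h hwb
      have h3 := @hUH b
      have h4 := @hWH b
      simp only [hA, mem_union, mem_filter, hFm, mem_erase]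
      clear * - h1 h2 h3 h4 hb hwb
      grind only
    · grw [card_union_le, card_union_le, card_union_le, card_union_le, card_union_le]
  rw [card_erase_of_mem (mem_erase.2 ⟨hwv.symm, hvH⟩), card_erase_of_mem hwH] at h1
  obtain ⟨a, ha, hva, hcard⟩ := hT.exists_of_not_isConnector hvF (A := A)
    (card_pos.1 (by omega)) (filter_subset _ _) (fun a ha => (mem_filter.1 ha).2.2) hno
  rw [hA, mem_filter] at ha
  obtain ⟨haF', haH, hwa⟩ := ha
  have haF := (hFm a).1 haF'
  have haQ : ∀ j, a ∉ Q j := fun j h => haF.1.2.2.2.2 ((hVQm a).2 ⟨j, h⟩)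
  have h3 : #(T.inNeighborsOutside X v) ≤ #{b ∈ F | T.Adj b v} + #(VQ.erase v) + #Z + #U +
      #(W.erase w) + #{c ∈ C | T.Adj c v} := by
    have : T.inNeighborsOutside X v ⊆ {b ∈ F | T.Adj b v} ∪ VQ.erase v ∪ Z ∪ U ∪ W.erase w ∪
        {c ∈ C | T.Adj c v} := by
      intro b hb
      rw [mem_inNeighborsOutside] at hb
      have h1 : b ≠ v := by rintro rfl; exact hT.1 _ hb.2
      have h2 : b ≠ w := by rintro rfl; exact hnwv hb.2
      simp only [mem_union, mem_filter, hFm, mem_erase]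
      clear * - h1 h2 hb
      grind only
    grw [this, card_union_le, card_union_le, card_union_le, card_union_le, card_union_le]
  have h4 : #{b ∈ F | T.Adj b a} + #(VQ \ Q₃.erase v) + 1 ≤ #(T.inNeighborsOutside X a) := by
    rw [← card_union_of_disjoint, ← card_insert_of_notMem (a := w)]
    · refine card_le_card fun b hb => ?_
      rw [mem_inNeighborsOutside]
      rcases mem_insert.1 hb with rfl | hb
      · exact ⟨hwX, hwa⟩
      rcases mem_union.1 hb with hb | hb
      · rw [mem_filter] at hb
        exact ⟨((hFm b).1 hb.1).1.1, hb.2⟩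
      · rw [mem_sdiff, mem_erase] at hb
        obtain ⟨j, hj⟩ := (hVQm b).1 hb.1
        refine ⟨fun h => hQ.avoid j b hj (by simp [h]), ?_⟩
        rcases eq_or_ne b v with rfl | hbv
        · exact hva
        · have hba : b ≠ a := by rintro rfl; exact haQ j hj
          refine (hT.total hba).resolve_right fun hab => hb.2 ⟨hbv, ?_⟩
          refine mem_biUnion.2 ⟨j, mem_univ j, List.mem_toFinset.2 ?_⟩
          exact hQ.mem_take_three hwS hwD hwQ (by simp [haF.1]) haQ
            (by rintro rfl; exact haH hwH) hwa hj hab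
    · intro h
      rcases mem_union.1 h with h | h
      · exact ((hFm w).1 (mem_filter.1 h).1).1.2.2.2.1 hw
      · exact hwVQ (mem_sdiff.1 h).1
    · rw [disjoint_left]
      intro b hb hb'
      exact ((hFm b).1 (mem_filter.1 hb).1).1.2.2.2.2 (mem_sdiff.1 hb').1
  -- with `α = #{c ∈ C | T.Adj c v}` and `β = #{c ∈ C | T.Adj w c}`, now
  -- `19 * k - 11 - β ≤ #A ≤ 14 * k - 7 + 2 * α`, where `#VQ` has cancelled
  have h5 := htop v hvH a haF.1.1 (by
    rintro ⟨j, rfl⟩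
    exact haQ j (List.mem_of_getLast? (hQ.last j))) haH
  have h6 := le_card_sdiff (Q₃.erase v) VQ
  have h7 := card_le_card hQ₃s
  have h8 := card_pos.2 ⟨v, hvQ₃⟩
  rw [card_erase_of_mem hvQ, card_erase_of_mem hw] at h3
  rw [card_erase_of_mem hvQ₃] at h6
  omega

end InDegree

/-! ### Joining the paths -/

theorem isPath_of_connectors {T : Digraph V} {F G : Finset V} {x u w v y : V} {l m q : List V}
    (hl : T.IsConnector F x u l) (huw : T.Adj u w) (hm : T.IsConnector G w v m)
    (hq : q.IsChain T.Adj) (hv : q.head? = some v) (hy : q.getLast? = some y)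
    (hnd : (x :: (l ++ u :: w :: (m ++ q))).Nodup) :
    T.IsPath x y (x :: (l ++ u :: w :: (m ++ q))) := by
  cases q with
  | nil => simp at hv
  | cons c q =>
    simp only [List.head?_cons, Option.some.injEq] at hv
    subst hv
    refine ⟨?_, hnd, rfl, ?_⟩
    · have h1 := hl.2.2.2
      have h2 := hm.2.2.2
      rw [← List.cons_append] at h1 h2 ⊢
      refine List.isChain_split.2 ⟨h1, List.isChain_cons_cons.2 ⟨huw, ?_⟩⟩
      exact List.isChain_split.2 ⟨h2, hq⟩
    · rw [← hy]
      simp [List.getLast?_cons, List.getLast?_append]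

end Digraph

theorem theorem1 (k : ℕ) {V : Type*} [Fintype V] (T : Digraph V) (hT : T.IsTournament)
    (hstrong : T.IsKStrong (13 * k - 6)) (hdeg : ∀ v, 28 * k - 13 ≤ T.outDegree v) :
    T.IsKLinked k := by
  classical
  open Finset in
  intro x y hx hy hxy
  rcases Nat.eq_zero_or_pos k with rfl | hk
  · exact ⟨fun _ => [], fun i => i.elim0, fun i => i.elim0⟩
  set X : Finset V := univ.image x with hXdef
  set Y : Finset V := univ.image y with hYdef
  have hX : #X = k := by rw [hXdef, card_image_of_injective _ hx, card_univ, Fintype.card_fin]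
  have hY : #Y = k := by rw [hYdef, card_image_of_injective _ hy, card_univ, Fintype.card_fin]
  have hxX : ∀ i, x i ∈ X := fun i => mem_image_of_mem _ (mem_univ i)
  have hyY : ∀ i, y i ∈ Y := fun i => mem_image_of_mem _ (mem_univ i)
  have hxy' : ∀ i j, x i ≠ y j := fun i j h => Set.disjoint_left.1 hxy ⟨i, h⟩ ⟨j, rfl⟩
  have hcard : 7 * k ≤ Fintype.card V := by
    have h1 := (hdeg (x ⟨0, hk⟩)).trans (Digraph.outDegree_le_card (S := univ.erase (x ⟨0, hk⟩))
      fun b hb _ => by simp [hb])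
    rw [card_erase_of_mem (mem_univ _), card_univ] at h1
    omega
  -- `5 * k` further vertices of largest in-degree
  obtain ⟨H, hHs, hH, htop⟩ := Digraph.exists_subset_card_eq_forall_le
    (fun v => #(T.inNeighborsOutside X v)) (X ∪ Y)ᶜ (5 * k) (by
      have := card_union_le X Y
      rw [card_compl]
      omega)
  have hHXY : ∀ h ∈ H, h ∉ X ∧ h ∉ Y := fun h hh => by simpa [X, Y] using hHs hh
  have hXH : Disjoint X H := disjoint_right.2 fun h hh => (hHXY h hh).1
  obtain ⟨u, hu, huH, hud⟩ := hT.exists_large_outDegree k H (by omega)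
  set U : Finset V := univ.image u with hUdef
  have hU : #U = k := by rw [hUdef, card_image_of_injective _ hu, card_univ, Fintype.card_fin]
  have huU : ∀ i, u i ∈ U := fun i => mem_image_of_mem _ (mem_univ i)
  have hUH : U ⊆ H := image_subset_iff.2 fun i _ => huH i
  obtain ⟨l, hl, hld⟩ := Digraph.exists_disjoint_connectors T x u (X ∪ Y ∪ H)ᶜ fun i C hC =>
    hT.exists_isConnector_to_top hk hX hY hH hXH
      (fun h hh a ha => htop h hh a (by simp only [mem_compl, mem_union] at ha ⊢; tauto)
        (by simp only [mem_union] at ha; tauto))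
      (hxX i) (huH i) (hdeg _) hC
  have hlm : ∀ i, ∀ z ∈ l i, z ∉ X ∧ z ∉ Y ∧ z ∉ H := fun i z hz => by
    have := (hl i).2.2.1 z hz
    simp only [mem_compl, mem_union] at this
    tauto
  set Z : Finset V := univ.biUnion fun i => (l i).toFinset with hZdef
  have hlZ : ∀ i, ∀ z ∈ l i, z ∈ Z := fun i z hz =>
    mem_biUnion.2 ⟨i, mem_univ i, List.mem_toFinset.2 hz⟩
  have hZm : ∀ z ∈ Z, z ∉ X ∧ z ∉ Y ∧ z ∉ H := fun z hz => by
    obtain ⟨i, -, hi⟩ := mem_biUnion.1 hz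
    exact hlm i z (List.mem_toFinset.1 hi)
  have hZ : #Z ≤ 2 * k := by
    refine (card_biUnion_le_card_mul _ _ 2 fun i _ => ?_).trans (by simp [mul_comm])
    exact (List.toFinset_card_le _).trans (hl i).1
  have hXZU : ∀ z, z ∈ X ∪ Z ∪ U ↔ z ∈ X ∨ z ∈ Z ∨ z ∈ U := fun z => by simp
  have hSD : ∀ s ∈ H \ U, s ∉ X ∪ Z ∪ U := fun s hs => by
    rw [mem_sdiff] at hs
    rw [hXZU]
    rintro (h | h | h)
    · exact (hHXY s hs.1).1 h
    · exact (hZm s h).2.2 hs.1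
    · exact hs.2 h
  have hHU := card_sdiff_of_subset hUH
  obtain ⟨Q₀, hQ₀⟩ := hstrong.exists_isLinkage (D := X ∪ Z ∪ U) (S := H \ U) hy (by
      have h1 := card_union_le (X ∪ Z) U
      have h2 := card_union_le X Z
      omega) (by omega) (disjoint_left.2 hSD)
    (fun j => by
      rw [hXZU]
      rintro (h | h | h)
      · obtain ⟨i, -, hi⟩ := mem_image.1 h
        exact hxy' i j hi
      · exact (hZm _ h).2.1 (hyY j)
      · exact (hHXY _ (hUH h)).2 (hyY j))
    (fun j h => (hHXY _ (mem_sdiff.1 h).1).2 (hyY j))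
  obtain ⟨Q, hQ⟩ := hQ₀.exists_isMinLinkage
  choose v hvS hv using hQ.head
  have hV : #(univ.image v) ≤ k := card_image_le.trans (by simp)
  -- `u i` has more than `k + i` out-neighbours in `H \ U`, at most `k` of which begin a path of `Q`
  obtain ⟨w, hw, hwS⟩ := Digraph.exists_injective_of_lt_card
    (fun i => {b ∈ H | b ∉ Set.range u ∧ T.Adj (u i) b} \ univ.image v) (fun i => by
      have h1 := hud i
      have h2 := le_card_sdiff (univ.image v) {b ∈ H | b ∉ Set.range u ∧ T.Adj (u i) b}
      have h3 := i.2
      omega)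
  simp only [mem_sdiff, mem_filter, mem_image, mem_univ, true_and] at hwS
  have hwHU : ∀ i, w i ∈ H \ U := fun i => mem_sdiff.2 ⟨(hwS i).1.1, by
    simpa [hUdef] using (hwS i).1.2.1⟩
  have hwQ : ∀ i j, w i ∉ Q j := fun i j h => by
    have := hQ.head_of_mem (hwHU i) h
    rw [hv, Option.some.injEq] at this
    exact (hwS i).2 ⟨j, this⟩
  set W : Finset V := univ.image w with hWdef
  have hW : #W = k := by rw [hWdef, card_image_of_injective _ hw, card_univ, Fintype.card_fin]
  have hwW : ∀ i, w i ∈ W := fun i => mem_image_of_mem _ (mem_univ i)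
  have hWH : W ⊆ H := image_subset_iff.2 fun i _ => (hwS i).1.1
  obtain ⟨m, hm, hmd⟩ := Digraph.exists_disjoint_connectors T w v
    (X ∪ Z ∪ U ∪ W ∪ univ.biUnion fun j => (Q j).toFinset)ᶜ fun i C hC =>
      hT.exists_isConnector_avoiding hk hX hZ hU hW hH hUH hWH hQ
        (fun h hh a haX haY haH => htop h hh a (by
          simp only [mem_compl, mem_union, not_or]
          exact ⟨haX, by simpa [hYdef] using haY⟩) haH)
        (hwW i) (hSD _ (hwHU i)) (hwQ i) (hv i) (hvS i) (hdeg _) hC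
  have hmm : ∀ i, ∀ z ∈ m i, z ∉ X ∧ z ∉ Z ∧ z ∉ U ∧ z ∉ W ∧ ∀ j, z ∉ Q j := fun i z hz => by
    have := (hm i).2.2.1 z hz
    simpa only [mem_compl, mem_union, not_or, and_assoc, mem_biUnion, mem_univ, true_and,
      List.mem_toFinset, not_exists] using this
  have hQm : ∀ j, ∀ z ∈ Q j, z ∉ X ∧ z ∉ Z ∧ z ∉ U := fun j z hz => by
    have := hQ.avoid j z hz
    rw [hXZU] at this
    tauto
  have hQd := hQ.disjoint
  have hxl : ∀ i j, x i ∉ l j := fun i j h => (hlm j _ h).1 (hxX i)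
  have hxu : ∀ i j, x i ≠ u j := fun i j h => (hHXY _ (huH j)).1 (h ▸ hxX i)
  have hxw : ∀ i j, x i ≠ w j := fun i j h => (hHXY _ (hwS j).1.1).1 (h ▸ hxX i)
  have hxm : ∀ i j, x i ∉ m j := fun i j h => (hmm j _ h).1 (hxX i)
  have hxQ : ∀ i j, x i ∉ Q j := fun i j h => (hQm j _ h).1 (hxX i)
  have hul : ∀ i j, u i ∉ l j := fun i j h => (hlm j _ h).2.2 (huH i)
  have huw : ∀ i j, u i ≠ w j := fun i j h => (hwS j).1.2.1 ⟨i, h⟩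
  have hum : ∀ i j, u i ∉ m j := fun i j h => (hmm j _ h).2.2.1 (huU i)
  have huQ : ∀ i j, u i ∉ Q j := fun i j h => (hQm j _ h).2.2 (huU i)
  have hwl : ∀ i j, w i ∉ l j := fun i j h => (hlm j _ h).2.2 (hwS i).1.1
  have hwm : ∀ i j, w i ∉ m j := fun i j h => (hmm j _ h).2.2.2.1 (hwW i)
  have hlm' : ∀ i j, (l i).Disjoint (m j) := fun i j z h h' => (hmm j z h').2.1 (hlZ i z h)
  have hlQ : ∀ i j, (l i).Disjoint (Q j) := fun i j z h h' => (hQm j z h').2.1 (hlZ i z h)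
  have hmQ : ∀ i j, (m i).Disjoint (Q j) := fun i j z h h' => (hmm i z h).2.2.2.2 j h'
  refine ⟨fun i => x i :: (l i ++ u i :: w i :: (m i ++ Q i)), fun i => ?_, fun i j hij => ?_⟩
  · refine Digraph.isPath_of_connectors (hl i) (hwS i).1.2.2 (hm i) (hQ.isChain i) (hv i)
      (hQ.last i) ?_
    have h1 := (hl i).2.1
    have h2 := (hm i).2.1
    have h3 := hQ.nodup i
    simp only [List.nodup_cons, List.nodup_append', List.mem_append, List.mem_cons, not_or,
      List.disjoint_cons_right, List.disjoint_append_right]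
    exact ⟨⟨hxl i i, hxu i i, hxw i i, hxm i i, hxQ i i⟩, h1, ⟨⟨huw i i, hum i i, huQ i i⟩,
      ⟨hwm i i, hwQ i i⟩, h2, h3, hmQ i i⟩, hul i i, hwl i i, hlm' i i, hlQ i i⟩
  · refine List.Disjoint.symm ?_
    simp only [List.disjoint_cons_left, List.disjoint_append_left, List.disjoint_cons_right,
      List.disjoint_append_right, List.mem_cons, List.mem_append, not_or]
    exact ⟨⟨hx.ne hij, hxl i j, hxu i j, hxw i j, hxm i j, hxQ i j⟩,
      ⟨hxl j i, hld j i hij.symm, hul j i, hwl j i, (hlm' i j).symm, (hlQ i j).symm⟩,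
      ⟨(hxu j i).symm, hul i j, hu.ne hij, huw i j, hum i j, huQ i j⟩,
      ⟨(hxw j i).symm, hwl i j, (huw j i).symm, hw.ne hij, hwm i j, hwQ i j⟩,
      ⟨hxm j i, hlm' j i, hum j i, hwm j i, hmd j i hij.symm, (hmQ i j).symm⟩,
      hxQ j i, hlQ j i, huQ j i, hwQ j i, hmQ j i, hQd j i hij.symm⟩
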